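/- **Setting.** Let $O\subset\mathbb R^2$ be a closed set of obstacle points, $R>0$ the radius of a disc-shaped robot and $\varepsilon>0$ a tolerance. Put $M_{\rm free}=\{x:\ |x-y|\ge R\ \text{for all } y\in O\}$. Paths are continuous paths in $M_{\rm free}$, homotopies are taken in $M_{\rm free}$ with fixed endpoints, and $g$ denotes length. Let $p_{start},p_{goal}\in M_{\rm free}$ be joined by a path of finite length; call a point reachable if it is joined to $p_{start}$ by a path of finite length. **Distinguished homotopies.** For a path $\gamma$ from $p_{start}$ to $p$ and a point $q\in M_{\rm free}$, let $\varphi_q^{-1}([\gamma])$ be the set of paths from $p_{start}$ to $q$ that visit $p$ at some time such that the part up to that time is homotopic to $\gamma$, and let $\min_{[\gamma]}g(q)$ be the infimum of the lengths of these paths. We write $[\gamma_1]\prec[\gamma_2]$ *for the goal* $q$ if $\min_{[\gamma_1]}g(q)<\min_{[\gamma_2]}g(q)$, and simply $[\gamma_1]\prec[\gamma_2]$ for $q=p_{goal}$. A set $\Omega\subset M_{\rm free}$ *satisfies the relaxation conditions* for $[\gamma_1],[\gamma_2]$ if $p_{start}\notin\Omega$, $p_{goal}\in\Omega$, and $[\gamma_1]\prec[\gamma_2]$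 for every goal $q$ that is a reachable collision-free point of the boundary of $\Omega$. It *is an $\Omega$ region* if moreover it is connected. **Topological tree.** A node with source point $p$ has finitely many rays from $p$ with increasing orientations $\theta$, each ending at the first obstacle point $e(\theta)$ it hits. The endpoints of two consecutive rays are at distance less than $2R$, unless there is a gap between the two rays. The $k$-th gap of node $i$ (source point $p=p^i$) comes from a short ray, of length $\Phi_{\rm near}$ and endpoint $e_{\rm n}$, which is one of these two consecutive rays, and a longer ray, of length $\Phi_{\rm far}$, whose endpoints are at distance at least $2R$ and such that $e_{\rm n}$ has distance less than $\varepsilon$ from the line of the long ray. Let $\vec a$ be the unit vector along the long ray and $\vec b$ the unit normal to it pointing away from the short ray, that is, $\vec a$ turned by $+\pi/2$ if the short ray has the smaller orientation and by $-\pi/2$ otherwise. The corridor is the collision-free part of $\{p+\phi\vec a+\psi\vec b:\ 0\le\phi\le\Phi_{\rm near},\ |\psi|\le R\}$, the critical point is $c_k^i=p+\Phi_{\rm near}\vec a+R\vec b$, assumed collision-free, and the edge $\alpha_k^i$ is a shortest path (of finite length) from $p$ to $c_k^i$ in the corridor. The gap sweeper $\Delta_k^i$ is the longest collision-free segment $\{p+\phi\vec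 a+R\vec b:\ \Phi_{\rm near}\le\phi\le\phi_o\}$ with $\phi_o\le\Phi_{\rm far}$; let $o_k^i$ be its endpoint and $e_{\rm f}\in O$ an obstacle point with $|e_{\rm f}-o_k^i|=R$ and $(e_{\rm f}-o_k^i)\cdot\vec a\ge0$. The other one of the two consecutive rays points at $e_{\rm f}$ or ends at distance less than $2R$ from it. The rays of the root, whose source point is $p_{start}$, make a full turn, consecutive ones enclosing an angle less than $\pi$. A child of node $i$ arises by expanding a critical point $c_k^i$: its source point is $c_k^i$ and its rays range over the orientations between those of $e_{\rm n}$ and $e_{\rm f}$ seen from $c_k^i$. Each critical point is expanded at most once. The contour of a node joins the endpoints of consecutive rays, through the points $e_{\rm n},c_k,o_k,e_{\rm f}$ at each gap; for a child it is closed by the polyline $e_{\rm n},c_k^i,o_k^i,e_{\rm f}$ of the gap of the parent that was expanded. The sub-region $Q^i$ consists of the collision-free points that lie on the contour, or are separated from infinity by it, and of the source point. The tree path of $c_k^i$ is the concatenation of the edges leading from $p_{start}$ to $c_k^i$, and $[c_k^i]$ is its distinguished homotopy. Let $P_i$ be the set of predecessors of node $i$, and $$U_{[c_k^i]}=M_{\rm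 free}\setminus\bigcup_{m\in P_i\cup\{i\}}Q^m .$$ **Theorem (Construction of the $\Omega$ region).** Let $c_k^i$ and $c_l^j$ be critical points of nodes $i,j$ of a topological tree, and suppose that $p_{goal}\notin Q^m$ for all $m\in P_i\cup\{i\}$. If $$\min_{[c_l^j]}g(m)<\min_{[c_k^i]}g(m)\qquad\text{for all } m\in\Delta_k^i,$$ then $U_{[c_k^i]}$ satisfies the relaxation conditions for $[c_l^j],[c_k^i]$; the connected component of $U_{[c_k^i]}$ that contains $p_{goal}$ is an $\Omega$ region for them, and so is $U_{[c_k^i]}$ itself if it is connected; and $[c_l^j]\prec[c_k^i]$. -/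

import Mathlib

open scoped ENNReal unitInterval

noncomputable section

namespace SNPP

/-- A planar environment: a closed set of obstacle points in the plane (identified with `ℂ`),
the radius `R` of the circular robot, and the tolerance `ε` of the raycasting. -/
structure World where
  obst : Set ℂ
  isClosed_obst : IsClosed obst
  R : ℝ
  R_pos : 0 < R
  ε : ℝ
  ε_pos : 0 < ε

namespace World

/-- The collision-free part of the environment: positions of the centre of the robot at which no
obstacle point lies in the interior of its footprint (touching an obstacle is allowed). -/
def free (W : World) : Set ℂ := {x | ∀ y ∈ W.obst, W.R ≤ dist x y}

/-- Collision-free locations, as a topological space. Its `Path`s are the collision-free paths, and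
`Path.Homotopic` is homotopy with fixed endpoints inside the collision-free part. -/
abbrev Conf (W : World) : Type := {x : ℂ // x ∈ W.free}

end World

variable {W : World}

/-- The length `g` of a path (possibly infinite). -/
def pathLength {x y : W.Conf} (γ : Path x y) : ℝ≥0∞ :=
  eVariationOn (fun t : I => ((γ t : W.Conf) : ℂ)) Set.univ

/-- `q` is joined to `s` by a collision-free path of finite length. -/
def Reachable (s q : W.Conf) : Prop := ∃ γ : Path s q, pathLength γ ≠ ∞

/-! ### Distinguished homotopies -/

/-- For a path `γ` from `s` to `p`, the paths from `s` to the (possibly fake) goal `q` that belong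
to the distinguished homotopy `[γ]`: those that visit `p` at some time `t`, the part up to the
time `t` being homotopic to `γ`. -/
def distinguished {s p : W.Conf} (γ : Path s p) (q : W.Conf) : Set (Path s q) :=
  {η | ∃ (t : I) (ht : η t = p), Path.Homotopic ((η.subpath 0 t).cast η.source.symm ht.symm) γ}

/-- The minimal length of the paths in `[γ]` that end at `q`, as an infimum. -/
def minLength {s p : W.Conf} (γ : Path s p) (q : W.Conf) : ℝ≥0∞ :=
  ⨅ η ∈ distinguished γ q, pathLength η

/-- Relative optimality `[γ₁] ≺ [γ₂]` of distinguished homotopies, for the goal `q`. -/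
def Prec {s p₁ p₂ : W.Conf} (q : W.Conf) (γ₁ : Path s p₁) (γ₂ : Path s p₂) : Prop :=
  minLength γ₁ q < minLength γ₂ q

/-- The requirements of goal location relaxation on a region `Ω`, apart from connectedness:
`Ω` is collision-free, contains the goal but not the start, and `[γ₁] ≺ [γ₂]` holds for every
collision-free point of the boundary of `Ω` taken as a fake goal (a fake goal has to be reachable,
otherwise there is no path to it at all). -/
structure IsRelaxation {s p₁ p₂ : W.Conf} (goal : W.Conf) (γ₁ : Path s p₁) (γ₂ : Path s p₂)
    (Ω : Set ℂ) : Prop where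
  subset_free : Ω ⊆ W.free
  start_notMem : (s : ℂ) ∉ Ω
  goal_mem : (goal : ℂ) ∈ Ω
  boundary : ∀ q : W.Conf, (q : ℂ) ∈ frontier Ω → Reachable s q → Prec q γ₁ γ₂

/-- `Ω` is a region as in goal location relaxation, connectedness included. -/
structure IsOmega {s p₁ p₂ : W.Conf} (goal : W.Conf) (γ₁ : Path s p₁) (γ₂ : Path s p₂)
    (Ω : Set ℂ) : Prop extends IsRelaxation goal γ₁ γ₂ Ω where
  connected : IsConnected Ω

/-! ### Rays, gaps, corridors and gap sweepers -/

/-- The unit vector with orientation `θ`. -/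
def dir (θ : ℝ) : ℂ := Complex.exp (θ * Complex.I)

/-- `θ` is an orientation of the point `x` as seen from `p`. -/
def IsOrientation (p x : ℂ) (θ : ℝ) : Prop := x - p = (‖x - p‖ : ℝ) • dir θ

/-- A ray from `p`, extended until it hits an obstacle: `len` is its length. -/
structure Ray (W : World) (p : W.Conf) where
  θ : ℝ
  len : ℝ
  isLeast_len : IsLeast {t : ℝ | 0 ≤ t ∧ (p : ℂ) + t • dir θ ∈ W.obst} len

/-- The obstacle point `e(θ)` hit by the ray. -/
def Ray.endpt {p : W.Conf} (r : Ray W p) : ℂ := (p : ℂ) + r.len • dir r.θ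

/-- Which ray of a gap comes first in the order of increasing orientation: the short one
(`nearFirst`) or the long one (`farFirst`). The two cases are mirror images. -/
inductive Side
  | nearFirst
  | farFirst

/-- The sign of the offset of the critical point from the long ray, away from the short ray. -/
def Side.sign : Side → ℝ
  | .nearFirst => 1
  | .farFirst => -1

/-- The point with coordinates `(x, y)` in the orthonormal frame `(a, b)` at `p`, where `a` is the
unit vector of orientation `θ` and `b` is `a` turned by a right angle. -/
def framePt (p : ℂ) (θ x y : ℝ) : ℂ := p + x • dir θ + y • dir (θ + Real.pi / 2)

/-- The corridor of a gap: the collision-free part of the rectangle of width `2R` that lies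
symmetrically on the long ray and is as long as the short ray. -/
def corridor {p : W.Conf} (near far : Ray W p) : Set W.Conf :=
  {z | ∃ x ∈ Set.Icc 0 near.len, ∃ y ∈ Set.Icc (-W.R) W.R, (z : ℂ) = framePt p far.θ x y}

/-- A gap of the node with source point `p`, whose short and long rays are `near` and `far`,
together with what planning in the corridor and sweeping the gap construct from it. -/
structure Gap (W : World) (p : W.Conf) where
  near : Ray W p
  far : Ray W p
  side : Side
  /-- the short ray is the first or the second one -/
  order : match side with
    | .nearFirst => near.θ < far.θ
    | .farFirst => far.θ < near.θ
  near_lt_far : near.len < far.len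
  /-- the robot may fit between the endpoints of the two rays -/
  not_close : 2 * W.R ≤ dist near.endpt far.endpt
  /-- the endpoint of the short ray is near the long ray -/
  near_eps : near.len ^ 2 - (inner ℝ (near.endpt - p) (far.endpt - p) / far.len) ^ 2 < W.ε ^ 2
  /-- the critical point, a corner of the corridor -/
  crit : W.Conf
  crit_eq : (crit : ℂ) = framePt p far.θ near.len (side.sign * W.R)
  /-- the edge: a shortest path from the source point to the critical point in the corridor -/
  edge : Path p crit
  edge_mem : ∀ t, edge t ∈ corridor near far
  edge_finite : pathLength edge ≠ ∞
  edge_min : ∀ β : Path p crit, (∀ t, β t ∈ corridor near far) → pathLength edge ≤ pathLength β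
  /-- how far along the long ray the sweeping from the critical point gets without collision -/
  reach : ℝ
  isGreatest_reach : IsGreatest {x : ℝ | x ∈ Set.Icc near.len far.len ∧
    ∀ x' ∈ Set.Icc near.len x, framePt p far.θ x' (side.sign * W.R) ∈ W.free} reach
  /-- the obstacle point that stops the sweeping: it touches the robot, not from behind -/
  stopper : ℂ
  stopper_mem : stopper ∈ W.obst
  dist_stopper : dist (framePt p far.θ reach (side.sign * W.R)) stopper = W.R
  stopper_ahead :
    0 ≤ inner ℝ (stopper - framePt p far.θ reach (side.sign * W.R)) (dir far.θ)

namespace Gap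

variable {p : W.Conf}

/-- The endpoint of the gap sweeper. -/
def sweepEnd (g : Gap W p) : ℂ := framePt p g.far.θ g.reach (g.side.sign * W.R)

/-- The gap sweeper: the segment checked from the critical point on, in the direction of the
long ray. -/
def sweeper (g : Gap W p) : Set W.Conf :=
  {z | ∃ x ∈ Set.Icc g.near.len g.reach, (z : ℂ) = framePt p g.far.θ x (g.side.sign * W.R)}

/-- The piece of contour through the endpoint of the short ray, the critical point, the endpoint
of the gap sweeper and the obstacle point that stopped the sweeping. -/
def contour (g : Gap W p) : Set ℂ :=
  segment ℝ g.near.endpt g.crit ∪ segment ℝ (g.crit : ℂ) g.sweepEnd ∪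
    segment ℝ g.sweepEnd g.stopper

/-- Among consecutive rays `r`, `r'`, the one that is the short ray of a gap between them. -/
def nearOf (g : Gap W p) (r r' : Ray W p) : Ray W p :=
  match g.side with
  | .nearFirst => r
  | .farFirst => r'

/-- Among consecutive rays `r`, `r'`, the one on the far side of a gap between them. -/
def farOf (g : Gap W p) (r r' : Ray W p) : Ray W p :=
  match g.side with
  | .nearFirst => r'
  | .farFirst => r

end Gap

/-! ### Nodes and their sub-regions -/

/-- An expanded node with source point `p`: its final list of rays in the order of increasing
orientation, and its gaps, the `k`-th one between the rays number `pos k` and `pos k + 1`. -/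
structure Node (W : World) (p : W.Conf) where
  n : ℕ
  ray : Fin (n + 1) → Ray W p
  strictMono_ray : StrictMono fun j => (ray j).θ
  numGaps : ℕ
  gap : Fin numGaps → Gap W p
  pos : Fin numGaps → Fin n
  strictMono_pos : StrictMono pos
  /-- where there is no gap, the robot cannot pass between the endpoints of consecutive rays -/
  close : ∀ j : Fin n, j ∉ Set.range pos →
    dist (ray j.castSucc).endpt (ray j.succ).endpt < 2 * W.R
  near_eq : ∀ k, (gap k).near = (gap k).nearOf (ray (pos k).castSucc) (ray (pos k).succ)
  far_mem : ∀ k, (gap k).far.θ ∈ Set.Icc (ray 0).θ (ray (Fin.last n)).θ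
  /-- a ray points at the obstacle that stopped the sweeping and the rays between it and the short
  ray are removed; further rays are removed only where the robot cannot pass -/
  stopper_ray : ∀ k,
    IsOrientation p (gap k).stopper
        ((gap k).farOf (ray (pos k).castSucc) (ray (pos k).succ)).θ ∨
      dist (gap k).stopper
        ((gap k).farOf (ray (pos k).castSucc) (ray (pos k).succ)).endpt < 2 * W.R

namespace Node

variable {p : W.Conf}

/-- The first orientation of the rays. -/
def θmin (N : Node W p) : ℝ := (N.ray 0).θ

/-- The last orientation of the rays. -/
def θmax (N : Node W p) : ℝ := (N.ray (Fin.last N.n)).θ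

/-- The contour formed by the endpoints of consecutive rays and the contours of the gaps. -/
def contour (N : Node W p) : Set ℂ :=
  (⋃ j ∈ (Set.range N.pos)ᶜ, segment ℝ (N.ray j.castSucc).endpt (N.ray j.succ).endpt) ∪
    ⋃ k, ((N.gap k).contour ∪ segment ℝ (N.gap k).stopper
      ((N.gap k).farOf (N.ray (N.pos k).castSucc) (N.ray (N.pos k).succ)).endpt)

/-- The rays of the root node make a full turn, consecutive ones enclosing less than a
straight angle. -/
structure IsRoot (N : Node W p) : Prop where
  full_turn : N.θmax = N.θmin + 2 * Real.pi
  step_lt : ∀ j : Fin N.n, (N.ray j.succ).θ - (N.ray j.castSucc).θ < Real.pi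

/-- The node `N`, whose source point is the critical point of the gap `g` of its parent, has rays
in the range of orientations that `g` prescribes: between the endpoint of the short ray and the
obstacle point that stopped the sweeping. -/
structure IsChild {p' : W.Conf} (g : Gap W p') (N : Node W g.crit) : Prop where
  range : match g.side with
    | .nearFirst => IsOrientation g.crit g.near.endpt N.θmin ∧
        IsOrientation g.crit g.stopper N.θmax
    | .farFirst => IsOrientation g.crit g.stopper N.θmin ∧
        IsOrientation g.crit g.near.endpt N.θmax
  min_nonneg : 0 ≤ N.θmin
  min_lt : N.θmin < 2 * Real.pi
  min_lt_max : N.θmin < N.θmax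
  max_lt : N.θmax < N.θmin + 2 * Real.pi

end Node

/-- The collision-free part of the region bounded by the contour `C` around the source point `p`:
the point `p`, the points of `C`, and those that `C` separates from infinity. -/
def enclosed (p : W.Conf) (C : Set ℂ) : Set ℂ :=
  {x | x ∈ W.free ∧ (x = p ∨ x ∈ C ∨ Bornology.IsBounded (connectedComponentIn Cᶜ x))}

/-! ### The topological tree -/

/-- A node of the hierarchical topological tree with start point `s`, given with the chain of its
predecessors: either the root, whose source point is `s`, or a child of a node `b`, obtained by
expanding the `k`-th critical point of `b`. -/
inductive Branch (s : W.Conf) : (p : W.Conf) → Node W p → Type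
  | root (N : Node W s) (h : N.IsRoot) : Branch s s N
  | child {p : W.Conf} {N : Node W p} (b : Branch s p N) (k : Fin N.numGaps)
      (N' : Node W (N.gap k).crit) (h : Node.IsChild (N.gap k) N') : Branch s (N.gap k).crit N'

namespace Branch

variable {s : W.Conf}

/-- The tree path of the source point of a node: the concatenation of edges. -/
def treePath {p : W.Conf} {N : Node W p} : Branch s p N → Path s p
  | root _ _ => Path.refl s
  | @child _ _ _ M b k _ _ => b.treePath.trans (M.gap k).edge

/-- The tree path of the `k`-th critical point of a node. -/
def critPath {p : W.Conf} {N : Node W p} (b : Branch s p N) (k : Fin N.numGaps) :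
    Path s (N.gap k).crit :=
  b.treePath.trans (N.gap k).edge

/-- The sub-region `Q` of a node. The contour of a node other than the root is closed by that of
the gap through which it is entered. -/
def subRegion {p : W.Conf} {N : Node W p} : Branch s p N → Set ℂ
  | root N _ => enclosed s N.contour
  | @child _ _ _ M _ k N' _ => enclosed (M.gap k).crit ((M.gap k).contour ∪ N'.contour)

/-- The union of the sub-regions of a node and of all its predecessors. -/
def covered {p : W.Conf} {N : Node W p} : Branch s p N → Set ℂ
  | root N h => (root N h).subRegion
  | child b k N' h => (child b k N' h).subRegion ∪ b.covered

/-- The uncovered region of the distinguished homotopies `[c_k]` of the critical points of a node: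
the collision-free area minus the sub-regions of the node and its predecessors. -/
def uncovered {p : W.Conf} {N : Node W p} (b : Branch s p N) : Set ℂ := W.free \ b.covered

end Branch

/-- A hierarchical topological tree at some stage of the planning: it has one root, contains the
parents of its nodes, and each critical point has been expanded at most once. -/
structure TopologicalTree (s : W.Conf) where
  mem : ∀ {p : W.Conf} {N : Node W p}, Branch s p N → Prop
  rootNode : Node W s
  isRoot : rootNode.IsRoot
  mem_root : ∀ N h, mem (Branch.root N h) ↔ N = rootNode
  mem_parent : ∀ {p : W.Conf} {N : Node W p} (b : Branch s p N) k N' h,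
    mem (Branch.child b k N' h) → mem b
  expand_unique : ∀ {p : W.Conf} {N : Node W p} (b : Branch s p N) k N₁ h₁ N₂ h₂,
    mem (Branch.child b k N₁ h₁) → mem (Branch.child b k N₂ h₂) → N₁ = N₂

end SNPP

end

namespace SNPP

open Set

variable {W : World}

/-! ### Lengths of paths -/

/-! A path in `[γ]` is constrained only up to its visit to the endpoint `p` of `γ`; afterwards it
may continue to the goal along any free path. Cutting at that visit and concatenating there show
that the minimal length of `[γ]` at `q` is `minLength γ p + freeDist p q`, while at any intermediate
point `c` it satisfies a triangle inequality (`minLength_add_freeDist_le`,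
`minLength_le_add_freeDist`).

With `c` the endpoint of `γ₂`, a strict inequality at `c` therefore propagates to every goal at
finite distance from `c` (`Prec.of_endpoint`). The critical point is the first point of its gap
sweeper and is reachable along its tree path, so the inequality on the sweeper yields the order for
every reachable goal, in particular on the boundary of any region and at `p_goal`. The start is
excluded because the root's sub-region contains it. -/

theorem pathLength_symm_le {x y : W.Conf} (γ : Path x y) : pathLength γ.symm ≤ pathLength γ :=
  eVariationOn.comp_le_of_antitoneOn (fun t : I => ((γ t : W.Conf) : ℂ)) unitInterval.symm
    (fun _ _ _ _ h => unitInterval.symm_le_symm.2 h) (mapsTo_univ _ _)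

theorem pathLength_refl (x : W.Conf) : pathLength (Path.refl x) = 0 :=
  eVariationOn.constant_on (by rintro _ ⟨_, _, rfl⟩ _ ⟨_, _, rfl⟩; rfl)

theorem eVariationOn_Icc_zero_add_Icc_one (f : I → ℂ) (t : I) :
    eVariationOn f (Icc 0 t) + eVariationOn f (Icc t 1) = eVariationOn f univ := by
  have h := eVariationOn.Icc_add_Icc f (s := univ) (unitInterval.nonneg' (t := t))
    (unitInterval.le_one' (t := t)) (mem_univ t)
  have h01 : Icc (0 : I) 1 = univ := eq_univ_of_forall fun _ =>
    ⟨unitInterval.nonneg', unitInterval.le_one'⟩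
  simpa only [univ_inter, h01] using h

theorem pathLength_trans_le {x y z : W.Conf} (γ : Path x y) (γ' : Path y z) :
    pathLength (γ.trans γ') ≤ pathLength γ + pathLength γ' := by
  let h : I := ⟨1 / 2, by norm_num, by norm_num⟩
  rw [pathLength, ← eVariationOn_Icc_zero_add_Icc_one _ h]
  refine add_le_add ?_ ?_
  -- `projIcc` clamps `2t` to a monotone self-map of `I`, which on `[0, 1/2]` is the parametrisation
  -- used by `trans`. The second half is treated in the same way with `2t - 1`.
  · refine le_trans (le_of_eq (eVariationOn.congr (fun t ht => ?_)))
      (eVariationOn.comp_le_of_monotoneOn (fun t : I => ((γ t : W.Conf) : ℂ)) (s := univ)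
        (fun t : I => projIcc (0 : ℝ) 1 zero_le_one (2 * t))
        (fun a _ b _ hab => monotone_projIcc _ (by
          have : (a : ℝ) ≤ b := hab
          linarith)) (mapsTo_univ _ _))
    have ht' : (t : ℝ) ≤ 1 / 2 := ht.2
    have hmem : 2 * (t : ℝ) ∈ Icc (0 : ℝ) 1 := ⟨by linarith [t.2.1], by linarith⟩
    simp only [Function.comp, Path.trans_apply, dif_pos ht', projIcc_of_mem _ hmem]
  · refine le_trans (le_of_eq (eVariationOn.congr (fun t ht => ?_)))
      (eVariationOn.comp_le_of_monotoneOn (fun t : I => ((γ' t : W.Conf) : ℂ)) (s := univ)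
        (fun t : I => projIcc (0 : ℝ) 1 zero_le_one (2 * t - 1))
        (fun a _ b _ hab => monotone_projIcc _ (by
          have : (a : ℝ) ≤ b := hab
          linarith)) (mapsTo_univ _ _))
    have ht' : 1 / 2 ≤ (t : ℝ) := ht.1
    have hmem : 2 * (t : ℝ) - 1 ∈ Icc (0 : ℝ) 1 := ⟨by linarith, by linarith [t.2.2]⟩
    simp only [Function.comp, Path.trans_apply, projIcc_of_mem _ hmem]
    split_ifs with h2
    -- At the junction `t = 1/2`, `trans` takes its first branch, so the end of `γ` must be
    -- identified with the start of `γ'`.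
    · have e : (t : ℝ) = 1 / 2 := le_antisymm h2 ht'
      have e1 : (⟨2 * (t : ℝ), (unitInterval.mul_pos_mem_iff zero_lt_two).2 ⟨t.2.1, h2⟩⟩ : I) = 1 :=
        Subtype.ext (by simp [e])
      have e2 : (⟨2 * (t : ℝ) - 1, hmem⟩ : I) = 0 := Subtype.ext (by simp [e])
      rw [e1, e2, γ.target, γ'.source]
    · rfl

theorem pathLength_subpath_le {x y : W.Conf} (γ : Path x y) {t₀ t₁ : I} (h : t₀ ≤ t₁) :
    pathLength (γ.subpath t₀ t₁) ≤
      eVariationOn (fun t : I => ((γ t : W.Conf) : ℂ)) (Icc t₀ t₁) := by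
  refine eVariationOn.comp_le_of_monotoneOn (fun t : I => ((γ t : W.Conf) : ℂ))
    (Icc.convexComb t₀ t₁) (fun a _ b _ hab => ?_) (fun s _ => ?_)
  · have hab' : (a : ℝ) ≤ b := hab
    have h' : (t₀ : ℝ) ≤ t₁ := h
    change (1 - (a : ℝ)) * t₀ + a * t₁ ≤ (1 - (b : ℝ)) * t₀ + b * t₁
    nlinarith
  · have := Path.range_subpathAux t₀ t₁ ▸ mem_range_self (f := Icc.convexComb t₀ t₁) s
    rwa [uIcc_of_le h] at this

theorem pathLength_subpath_add_le {x y : W.Conf} (γ : Path x y) (t : I) :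
    pathLength (γ.subpath 0 t) + pathLength (γ.subpath t 1) ≤ pathLength γ :=
  (add_le_add (pathLength_subpath_le γ unitInterval.nonneg')
    (pathLength_subpath_le γ unitInterval.le_one')).trans_eq
      (eVariationOn_Icc_zero_add_Icc_one _ t)

theorem Reachable.symm {s q : W.Conf} (h : Reachable s q) : Reachable q s :=
  let ⟨γ, hγ⟩ := h
  ⟨γ.symm, ne_top_of_le_ne_top hγ (pathLength_symm_le γ)⟩

theorem Reachable.trans {s p q : W.Conf} (h : Reachable s p) (h' : Reachable p q) :
    Reachable s q :=
  let ⟨γ, hγ⟩ := h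
  let ⟨γ', hγ'⟩ := h'
  ⟨γ.trans γ', ne_top_of_le_ne_top (ENNReal.add_ne_top.2 ⟨hγ, hγ'⟩) (pathLength_trans_le γ γ')⟩

/-- The infimum of the lengths of the collision-free paths from `p` to `q`. -/
noncomputable def freeDist (p q : W.Conf) : ℝ≥0∞ := ⨅ β : Path p q, pathLength β

theorem Reachable.freeDist_ne_top {p q : W.Conf} (h : Reachable p q) : freeDist p q ≠ ∞ :=
  let ⟨β, hβ⟩ := h
  ne_top_of_le_ne_top hβ (iInf_le _ β)

/-! ### Minimal lengths in distinguished homotopies -/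

/-- Appending `β` leaves the part up to the visit to `p` untouched: `trans` runs through `η` at
double speed, so the visit moves from time `t` to `t / 2`. -/
theorem trans_mem_distinguished {s p c q : W.Conf} {γ : Path s p} {η : Path s c}
    (hη : η ∈ distinguished γ c) (β : Path c q) : η.trans β ∈ distinguished γ q := by
  obtain ⟨t, ht, hom⟩ := hη
  have key : ∀ (u : ℝ) (hu : u ∈ I) (hu2 : u / 2 ∈ I), (η.trans β) ⟨u / 2, hu2⟩ = η ⟨u, hu⟩ := by
    intro u hu hu2
    rw [Path.trans_apply, dif_pos (by simpa using div_le_div_of_nonneg_right hu.2 zero_le_two)]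
    congr 2
    simp only
    ring
  have ht2 : (t : ℝ) / 2 ∈ I := ⟨by linarith [t.2.1], by linarith [t.2.2]⟩
  refine ⟨⟨t / 2, ht2⟩, (key t t.2 ht2).trans ht, ?_⟩
  -- The two initial parts coincide pointwise, so no homotopy has to be constructed.
  convert hom using 1
  ext r
  have hr : (r : ℝ) * t ∈ I := ⟨mul_nonneg r.2.1 t.2.1, mul_le_one₀ r.2.2 t.2.1 t.2.2⟩
  have hr2 : (r : ℝ) * t / 2 ∈ I := ⟨by linarith [hr.1], by linarith [hr.1, hr.2]⟩
  have e1 : Icc.convexComb (0 : I) ⟨(t : ℝ) / 2, ht2⟩ r = ⟨r * t / 2, hr2⟩ :=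
    Subtype.ext (by simp [Icc.convexComb]; ring)
  have e2 : Icc.convexComb (0 : I) t r = ⟨r * t, hr⟩ :=
    Subtype.ext (by simp [Icc.convexComb])
  change (((η.trans β) (Icc.convexComb (0 : I) ⟨(t : ℝ) / 2, ht2⟩ r) : W.Conf) : ℂ) =
    ((η (Icc.convexComb (0 : I) t r) : W.Conf) : ℂ)
  rw [e1, e2, key _ hr hr2]

theorem minLength_le_add_freeDist {s p : W.Conf} (γ : Path s p) (c q : W.Conf) :
    minLength γ q ≤ minLength γ c + freeDist c q := by
  simp only [minLength, freeDist, ENNReal.iInf_add, ENNReal.add_iInf]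
  exact le_iInf fun β => le_iInf fun η => le_iInf fun hη =>
    (iInf₂_le (η.trans β) (trans_mem_distinguished hη β)).trans (pathLength_trans_le η β)

/-- A path in `[γ]` consists of a path homotopic to `γ` and of a path from its end to the goal. -/
theorem minLength_add_freeDist_le {s p : W.Conf} (γ : Path s p) (q : W.Conf) :
    minLength γ p + freeDist p q ≤ minLength γ q := by
  refine le_iInf₂ fun η hη => ?_
  obtain ⟨t, ht, hom⟩ := hη
  refine le_trans (add_le_add ?_ ?_) (pathLength_subpath_add_le η t)
  -- The initial part ends at `p`, so it visits `p` at time `1`, and its subpath up to that time is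
  -- the whole of it.
  · refine iInf₂_le ((η.subpath 0 t).cast η.source.symm ht.symm) ⟨1, Path.target _, ?_⟩
    convert hom using 1
    rw [Path.subpath_zero_one]
    rfl
  · exact iInf_le _ ((η.subpath t 1).cast ht.symm η.target.symm)

/-- Relative optimality for the endpoint of `γ₂` carries over to every reachable goal. -/
theorem Prec.of_endpoint {s p₁ p₂ : W.Conf} {γ₁ : Path s p₁} {γ₂ : Path s p₂}
    (h : Prec p₂ γ₁ γ₂) {q : W.Conf} (hq : Reachable p₂ q) : Prec q γ₁ γ₂ :=
  calc minLength γ₁ q ≤ minLength γ₁ p₂ + freeDist p₂ q := minLength_le_add_freeDist γ₁ p₂ q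
    -- Reachability makes the added distance finite, which keeps the inequality strict in `ℝ≥0∞`.
    _ < minLength γ₂ p₂ + freeDist p₂ q := ENNReal.add_lt_add_right hq.freeDist_ne_top h
    _ ≤ minLength γ₂ q := minLength_add_freeDist_le γ₂ q

/-! ### The topological tree -/

theorem Gap.crit_mem_sweeper {p : W.Conf} (g : Gap W p) : g.crit ∈ g.sweeper :=
  ⟨g.near.len, ⟨le_rfl, g.isGreatest_reach.1.1.1⟩, g.crit_eq⟩

namespace Branch

variable {s : W.Conf}

theorem pathLength_treePath_ne_top {p : W.Conf} {N : Node W p} (b : Branch s p N) :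
    pathLength b.treePath ≠ ∞ := by
  induction b with
  | root N h => simp [treePath, pathLength_refl]
  | @child p M b k N' h ih =>
    exact ne_top_of_le_ne_top (ENNReal.add_ne_top.2 ⟨ih, (M.gap k).edge_finite⟩)
      (pathLength_trans_le _ _)

theorem reachable_crit {p : W.Conf} {N : Node W p} (b : Branch s p N) (k : Fin N.numGaps) :
    Reachable s (N.gap k).crit :=
  Reachable.trans ⟨b.treePath, b.pathLength_treePath_ne_top⟩
    ⟨(N.gap k).edge, (N.gap k).edge_finite⟩

/-- Every chain of predecessors ends at the root, whose sub-region contains its own source point by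
definition. -/
theorem start_mem_covered {p : W.Conf} {N : Node W p} (b : Branch s p N) :
    (s : ℂ) ∈ b.covered := by
  induction b with
  | root N h => exact ⟨s.2, Or.inl rfl⟩
  | child b k N' h ih => exact Or.inr ih

end Branch

end SNPP

theorem mainTheorem2 {W : SNPP.World} (start goal : W.Conf)
    (hreach : SNPP.Reachable start goal) (T : SNPP.TopologicalTree start)
    {pᵢ pⱼ : W.Conf} {Nᵢ : SNPP.Node W pᵢ} {Nⱼ : SNPP.Node W pⱼ}
    (i : SNPP.Branch start pᵢ Nᵢ) (hi : T.mem i) (k : Fin Nᵢ.numGaps)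
    (j : SNPP.Branch start pⱼ Nⱼ) (hj : T.mem j) (l : Fin Nⱼ.numGaps)
    (hgoal : (goal : ℂ) ∉ i.covered)
    (hlt : ∀ m ∈ (Nᵢ.gap k).sweeper,
      SNPP.minLength (j.critPath l) m < SNPP.minLength (i.critPath k) m) :
    SNPP.IsRelaxation goal (j.critPath l) (i.critPath k) i.uncovered ∧
      SNPP.IsOmega goal (j.critPath l) (i.critPath k) (connectedComponentIn i.uncovered goal) ∧
      (IsConnected i.uncovered →
        SNPP.IsOmega goal (j.critPath l) (i.critPath k) i.uncovered) ∧
      SNPP.Prec goal (j.critPath l) (i.critPath k) := by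
  -- The critical point is joined to `q` with finite length by going back to the start and on to
  -- `q`.
  have hprec : ∀ q : W.Conf, SNPP.Reachable start q →
      SNPP.Prec q (j.critPath l) (i.critPath k) := fun q hq =>
    SNPP.Prec.of_endpoint (hlt _ (Nᵢ.gap k).crit_mem_sweeper) ((i.reachable_crit k).symm.trans hq)
  have hmem : (goal : ℂ) ∈ i.uncovered := ⟨goal.2, hgoal⟩
  have hstart : (start : ℂ) ∉ i.uncovered := fun h => h.2 i.start_mem_covered
  have hrel : SNPP.IsRelaxation goal (j.critPath l) (i.critPath k) i.uncovered :=
    ⟨Set.sdiff_subset, hstart, hmem, fun q _ hq => hprec q hq⟩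
  have hsub := connectedComponentIn_subset i.uncovered (goal : ℂ)
  -- The order holds at every reachable point, so the frontier of the component need not be compared
  -- with that of the uncovered region.
  exact ⟨hrel,
    ⟨⟨hsub.trans hrel.subset_free, fun h => hstart (hsub h), mem_connectedComponentIn hmem,
      fun q _ hq => hprec q hq⟩, isConnected_connectedComponentIn_iff.2 hmem⟩,
    fun hc => ⟨hrel, hc⟩, hprec goal hreach⟩
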